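/- Let $n,m\ge 1$ be integers and $1<p<\infty$, with Hölder conjugate $p'=p/(p-1)$. A flag rectangle in $\mathbb R^n\times\mathbb R^m$ is a set $R=I\times J$, where $I\subset\mathbb R^n$ and $J\subset\mathbb R^m$ are axes-parallel cubes of side lengths $0<\ell(I)\le\ell(J)$; let $\mathcal R_{\mathcal F}$ be the collection of all flag rectangles. Write $\langle b\rangle_R=\frac1{|R|}\int_R b$. The little flag BMO space $\mathrm{bmo}_{\mathcal F}(\mathbb R^n\times\mathbb R^m)$ consists of the locally integrable functions $b$ with $$\sup_{R\in\mathcal R_{\mathcal F}}\frac1{|R|}\int_R |b(x,y)-\langle b\rangle_R|\,dx\,dy<\infty,$$ and the flag Muckenhoupt class $A_{\mathcal F,p}$ consists of the (almost everywhere) positive, locally integrable functions $w$ on $\mathbb R^n\times\mathbb R^m$ with $$\sup_{R\in\mathcal R_{\mathcal F}}\left(\frac1{|R|}\int_R w\,dx\,dy\right)\left(\frac1{|R|}\int_R w^{1-p'}\,dx\,dy\right)^{p-1}<\infty .$$ Let $w$ be an almost everywhere positive function on $\mathbb R^n\times\mathbb R^m$. Then: (i) if $w\in A_{\mathcal F,p}$,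 then $\log w\in\mathrm{bmo}_{\mathcal F}(\mathbb R^n\times\mathbb R^m)$; (ii) if $\log w\in\mathrm{bmo}_{\mathcal F}(\mathbb R^n\times\mathbb R^m)$, then there is $\eta_0>0$ such that $w^\eta\in A_{\mathcal F,p}$ for every $0<\eta<\eta_0$. -/

import Mathlib

open MeasureTheory

noncomputable section

/-- The space `ℝⁿ × ℝᵐ`, with its product topology and Lebesgue measure (`volume`). -/
abbrev FlagSpace (n m : ℕ) : Type := (Fin n → ℝ) × (Fin m → ℝ)

/-- The closed axes-parallel cube in `ℝᵈ` with lower corner `a` and side length `s`. -/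
def axisCube {d : ℕ} (a : Fin d → ℝ) (s : ℝ) : Set (Fin d → ℝ) :=
  Set.Icc a (fun i => a i + s)

/-- The flag rectangles: products `I ×ˢ J` of nondegenerate cubes `I ⊆ ℝⁿ`, `J ⊆ ℝᵐ`
whose side lengths satisfy `ℓ(I) ≤ ℓ(J)`. -/
def flagRectangles (n m : ℕ) : Set (Set (FlagSpace n m)) :=
  {R | ∃ (a : Fin n → ℝ) (c : Fin m → ℝ) (s t : ℝ),
    0 < s ∧ s ≤ t ∧ R = axisCube a s ×ˢ axisCube c t}

/-- The little flag BMO norm, with values in `[0, ∞]`: the supremum over flag rectangles of the mean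
oscillation of `b`. -/
def flagBmoNorm {n m : ℕ} (b : FlagSpace n m → ℝ) : ENNReal :=
  ⨆ R ∈ flagRectangles n m, ⨍⁻ z in R, ENNReal.ofReal |b z - ⨍ z' in R, b z' ∂volume| ∂volume

/-- The little flag BMO space: locally integrable functions with finite little flag BMO norm. -/
def flagBmo (n m : ℕ) : Set (FlagSpace n m → ℝ) :=
  {b | LocallyIntegrable b volume ∧ flagBmoNorm b < ⊤}

/-- The flag Muckenhoupt characteristic of `w`, with values in `[0, ∞]`. The Hölder conjugate
of `p` is `p / (p - 1)`, and integrals of positive functions may be infinite. -/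
def flagApConst {n m : ℕ} (p : ℝ) (w : FlagSpace n m → ℝ) : ENNReal :=
  ⨆ R ∈ flagRectangles n m,
    (⨍⁻ z in R, ENNReal.ofReal (w z) ∂volume) *
      (⨍⁻ z in R, ENNReal.ofReal (w z ^ (1 - p / (p - 1))) ∂volume) ^ (p - 1)

/-- The flag Muckenhoupt class: (almost everywhere) positive, locally integrable functions with
finite flag Muckenhoupt characteristic. -/
def flagAp (n m : ℕ) (p : ℝ) : Set (FlagSpace n m → ℝ) :=
  {w | (∀ᵐ z, 0 < w z) ∧ LocallyIntegrable w volume ∧ flagApConst p w < ⊤}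

end

open Filter Topology Metric

/-! For (i), put b = log w and q = p - 1, so that 1 - p' = -1/q. On a flag rectangle, Jensen makes
both factors of the A_p product, recentred at the mean of b, at least 1; their product is bounded,
hence so is each. Since |x| ≤ e^x + q e^(-x/q), they bound the mean oscillation
(`integral_abs_sub_integral_le`).

For (ii), halving all sides of a flag rectangle gives 2^(n+m) flag rectangles of equal volume and
unchanged eccentricity, so the averages of b are harmonic on a homogeneous tree. A stopping argument
there gives John–Nirenberg (`descendantMean_exp_le`) with constants independent of the eccentricity;
Lebesgue differentiation and Fatou carry it to b (`setLAverage_exp_le`). The uniform bound on the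
mean of exp(l|b - avg|) controls both A_p factors of w^η once η ≤ l and η ≤ l(p - 1), and the
exponentials of the averages cancel (`rpow_mem_flagAp`). -/

/-- A rooted tree whose nodes all have children indexed by `K`, with the mean over the
`k`-th generation descending from a node. -/
noncomputable def descendantMean {T K : Type*} [Fintype K] (child : T → K → T) :
    ℕ → (T → ℝ) → T → ℝ
  | 0, g, Q => g Q
  | k + 1, g, Q => (Fintype.card K : ℝ)⁻¹ * ∑ e, descendantMean child k g (child Q e)

/-! ### Harmonic functions and John–Nirenberg on a homogeneous tree -/

section Tree

variable {T K : Type*} [Fintype K] {child : T → K → T}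

theorem descendantMean_mono {f g : T → ℝ} (h : ∀ Q, f Q ≤ g Q) (k : ℕ) (Q : T) :
    descendantMean child k f Q ≤ descendantMean child k g Q := by
  induction k generalizing Q with
  | zero => exact h Q
  | succ k ih =>
    exact mul_le_mul_of_nonneg_left (Finset.sum_le_sum fun e _ => ih _) (by positivity)

theorem descendantMean_const_mul (f : T → ℝ) (c : ℝ) (k : ℕ) (Q : T) :
    descendantMean child k (fun Q => c * f Q) Q = c * descendantMean child k f Q := by
  induction k generalizing Q with
  | zero => rfl
  | succ k ih => simp only [descendantMean, ih, ← Finset.mul_sum]; ring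

theorem mean_le_mean {f g : K → ℝ} (h : ∀ e, f e ≤ g e) :
    (Fintype.card K : ℝ)⁻¹ * ∑ e, f e ≤ (Fintype.card K : ℝ)⁻¹ * ∑ e, g e :=
  mul_le_mul_of_nonneg_left (Finset.sum_le_sum fun e _ => h e) (by positivity)

/-- The triangle inequality, applied generation by generation. In the stopping argument it makes a
large deviation at a stopped node persist in the mean below it. -/
theorem abs_sub_le_descendantMean [Nonempty K] {A : T → ℝ}
    (hA : ∀ Q, A Q = (Fintype.card K : ℝ)⁻¹ * ∑ e, A (child Q e)) (α : ℝ) (k : ℕ) (Q : T) :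
    |A Q - α| ≤ descendantMean child k (fun Q' => |A Q' - α|) Q := by
  induction k generalizing Q with
  | zero => exact le_rfl
  | succ k ih =>
    have hc : (Fintype.card K : ℝ) ≠ 0 := by positivity
    have h1 : A Q - α = (Fintype.card K : ℝ)⁻¹ * ∑ e, (A (child Q e) - α) := by
      rw [hA Q, Finset.sum_sub_distrib, mul_sub]
      simp [Finset.card_univ, hc]
    rw [h1, abs_mul, abs_of_nonneg (by positivity : (0 : ℝ) ≤ (Fintype.card K : ℝ)⁻¹)]
    refine (mul_le_mul_of_nonneg_left (Finset.abs_sum_le_sum_abs _ _) (by positivity)).trans ?_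
    exact mean_le_mean fun e => ih _

/-- The John–Nirenberg inequality on a homogeneous tree. -/
theorem descendantMean_exp_le [Nonempty K] {A : T → ℝ}
    (hA : ∀ Q, A Q = (Fintype.card K : ℝ)⁻¹ * ∑ e, A (child Q e)) {M l : ℝ} (hM : 0 < M)
    (hl : 0 ≤ l) (hosc : ∀ k Q, descendantMean child k (fun Q' => |A Q' - A Q|) Q ≤ M)
    (hlM : Real.exp (l * (2 * M + Fintype.card K * M)) ≤ 3 / 2) (k : ℕ) (Q : T) :
    descendantMean child k (fun Q' => Real.exp (l * |A Q' - A Q|)) Q ≤ 6 := by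
  have hc : (0 : ℝ) < Fintype.card K := by positivity
  -- One child carries at most `card K` times the mean over all children.
  have hstep : ∀ Q e, |A (child Q e) - A Q| ≤ Fintype.card K * M := by
    intro Q e
    have h := hosc 1 Q
    simp only [descendantMean] at h
    rw [inv_mul_le_iff₀ hc] at h
    exact (Finset.single_le_sum (f := fun e => |A (child Q e) - A Q|)
      (fun e _ => abs_nonneg _) (Finset.mem_univ e)).trans h
  have h2M : Real.exp (l * (2 * M)) ≤ 3 / 2 := by
    refine (Real.exp_le_exp.2 ?_).trans hlM
    exact mul_le_mul_of_nonneg_left (by nlinarith) hl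
  induction k using Nat.strong_induction_on generalizing Q with
  | _ k ih =>
    set α := A Q with hα
    -- Stopping argument: descend from `Q` while the deviation from `α` stays within `2 * M`. Leaves
    -- reached without stopping cost at most 3/2; stopped branches are charged to the mean of |A -
    -- α|.
    have key : ∀ j, j ≤ k → ∀ P, |A P - α| ≤ 2 * M →
        descendantMean child j (fun Q' => Real.exp (l * |A Q' - α|)) P ≤
          3 / 2 + 9 / (2 * M) * descendantMean child j (fun Q' => |A Q' - α|) P := by
      intro j
      induction j with
      | zero =>
        intro _ P hP
        have h1 : Real.exp (l * |A P - α|) ≤ 3 / 2 :=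
          (Real.exp_le_exp.2 (mul_le_mul_of_nonneg_left hP hl)).trans h2M
        have h2 : 0 ≤ 9 / (2 * M) * |A P - α| := by positivity
        simp only [descendantMean]
        linarith
      | succ j ihj =>
        intro hj P hP
        have hsum : (3 / 2 + 9 / (2 * M) *
            descendantMean child (j + 1) (fun Q' => |A Q' - α|) P) =
            (Fintype.card K : ℝ)⁻¹ * ∑ e, (3 / 2 + 9 / (2 * M) *
              descendantMean child j (fun Q' => |A Q' - α|) (child P e)) := by
          rw [Finset.sum_add_distrib, mul_add, ← Finset.mul_sum]
          simp only [descendantMean, Finset.sum_const, Finset.card_univ, nsmul_eq_mul]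
          field_simp
        rw [hsum]
        refine mean_le_mean fun e => ?_
        rcases le_or_gt |A (child P e) - α| (2 * M) with hch | hch
        · exact ihj (by omega) _ hch
        -- A stopped child overshoots by at most one step, and it has fewer than `k` generations
        -- below it, so the outer induction gives 3/2 * 6 = 9.
        have h1 : descendantMean child j (fun Q' => Real.exp (l * |A Q' - α|)) (child P e) ≤ 9 := by
          have h2 : ∀ Q', Real.exp (l * |A Q' - α|) ≤
              3 / 2 * Real.exp (l * |A Q' - A (child P e)|) := by
            intro Q'
            have h3 : |A (child P e) - α| ≤ 2 * M + Fintype.card K * M := by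
              have := abs_sub_le (A (child P e)) (A P) α
              linarith [hstep P e]
            have h4 := abs_sub_le (A Q') (A (child P e)) α
            calc Real.exp (l * |A Q' - α|)
                ≤ Real.exp (l * (2 * M + Fintype.card K * M) + l * |A Q' - A (child P e)|) := by
                  rw [← mul_add]
                  exact Real.exp_le_exp.2 (mul_le_mul_of_nonneg_left (by linarith) hl)
              _ ≤ _ := by
                  rw [Real.exp_add]
                  exact mul_le_mul_of_nonneg_right hlM (Real.exp_pos _).le
          refine (descendantMean_mono h2 j _).trans ?_
          rw [descendantMean_const_mul]
          have := ih j (by omega) (child P e)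
          linarith
        have h5 := abs_sub_le_descendantMean hA α j (child P e)
        have h6 : 9 ≤ 9 / (2 * M) *
            descendantMean child j (fun Q' => |A Q' - α|) (child P e) := by
          rw [div_mul_eq_mul_div, le_div_iff₀ (by positivity)]
          nlinarith
        linarith
    have h := key k le_rfl Q (by simp [hα, hM.le])
    -- The bound 6 reproduces itself: 3/2 + (3/2 * 6)/2 = 6.
    have h7 : 9 / (2 * M) * descendantMean child k (fun Q' => |A Q' - α|) Q ≤ 9 / 2 := by
      rw [div_mul_eq_mul_div, div_le_div_iff₀ (by positivity) (by norm_num)]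
      nlinarith [hosc k Q]
    linarith

end Tree

theorem descendantMean_of_harmonic {T K : Type*} [Fintype K] {child : T → K → T} {A : T → ℝ}
    (hA : ∀ Q, A Q = (Fintype.card K : ℝ)⁻¹ * ∑ e, A (child Q e)) (k : ℕ) (Q : T) :
    descendantMean child k A Q = A Q := by
  induction k generalizing Q with
  | zero => rfl
  | succ k ih => simp only [descendantMean, ih, ← hA]

theorem descendantMean_nonneg {T K : Type*} [Fintype K] {child : T → K → T} {g : T → ℝ}
    (hg : ∀ Q, 0 ≤ g Q) (k : ℕ) (Q : T) : 0 ≤ descendantMean child k g Q := by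
  induction k generalizing Q with
  | zero => exact hg Q
  | succ k ih => exact mul_nonneg (by positivity) (Finset.sum_nonneg fun e _ => ih _)

/-! ### Dyadic halving of cubes -/

section HalfOpenCube

variable {d : ℕ}

/-- The half-open axes-parallel cube in `ℝᵈ` with lower corner `a` and side length `s`. -/
def halfOpenCube (a : Fin d → ℝ) (s : ℝ) : Set (Fin d → ℝ) :=
  Set.univ.pi fun i => Set.Ico (a i) (a i + s)

/-- The lower corner of the dyadic child of the cube with corner `a` and side length `s`
selected by `e`. -/
noncomputable def halfCorner (a : Fin d → ℝ) (s : ℝ) (e : Fin d → Bool) : Fin d → ℝ :=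
  fun i => a i + if e i then s / 2 else 0

/-- The index of the dyadic child containing `x`. -/
noncomputable def halfIndex (a : Fin d → ℝ) (s : ℝ) (x : Fin d → ℝ) : Fin d → Bool :=
  fun i => decide (a i + s / 2 ≤ x i)

/-- Half-open cubes make the children an exact partition, indexed by the halves in which the
coordinates lie. -/
theorem mem_halfOpenCube_halfCorner {a : Fin d → ℝ} {s : ℝ} (hs : 0 < s) {e : Fin d → Bool}
    {x : Fin d → ℝ} : x ∈ halfOpenCube (halfCorner a s e) (s / 2) ↔
      x ∈ halfOpenCube a s ∧ halfIndex a s x = e := by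
  simp only [halfOpenCube, halfCorner, halfIndex, Set.mem_univ_pi, Set.mem_Ico, funext_iff,
    ← forall_and]
  refine forall_congr' fun i => ?_
  cases e i
  · simp only [Bool.false_eq_true, if_false, decide_eq_false_iff_not, not_le]
    constructor
    · rintro ⟨h1, h2⟩; exact ⟨⟨by linarith, by linarith⟩, by linarith⟩
    · rintro ⟨⟨h1, h2⟩, h3⟩; exact ⟨by linarith, by linarith⟩
  · simp only [if_true, decide_eq_true_eq]
    constructor
    · rintro ⟨h1, h2⟩; exact ⟨⟨by linarith, by linarith⟩, by linarith⟩
    · rintro ⟨⟨h1, h2⟩, h3⟩; exact ⟨by linarith, by linarith⟩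

theorem measurableSet_halfOpenCube (a : Fin d → ℝ) (s : ℝ) : MeasurableSet (halfOpenCube a s) :=
  MeasurableSet.univ_pi fun _ => measurableSet_Ico

theorem measurable_halfIndex (a : Fin d → ℝ) (s : ℝ) : Measurable (halfIndex a s) := by
  refine measurable_pi_lambda _ fun i => measurable_to_bool ?_
  have : (fun x : Fin d → ℝ => halfIndex a s x i) ⁻¹' {true} = {x | a i + s / 2 ≤ x i} := by
    ext x; simp [halfIndex]
  rw [this]
  exact measurableSet_le measurable_const (measurable_pi_apply i)

theorem halfOpenCube_ae_eq_axisCube (a : Fin d → ℝ) (s : ℝ) :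
    halfOpenCube a s =ᵐ[volume] axisCube a s :=
  Measure.univ_pi_Ico_ae_eq_Icc

theorem volume_axisCube (a : Fin d → ℝ) (s : ℝ) :
    volume (axisCube a s) = ENNReal.ofReal s ^ d := by
  simp [axisCube, Real.volume_Icc_pi]

end HalfOpenCube

/-! ### The dyadic tree below a flag rectangle -/

/-- A parametrized flag rectangle. -/
structure FlagRect (n m : ℕ) where
  a : Fin n → ℝ
  c : Fin m → ℝ
  s : ℝ
  t : ℝ
  s_pos : 0 < s
  s_le : s ≤ t

namespace FlagRect

variable {n m : ℕ}

theorem t_pos (Q : FlagRect n m) : 0 < Q.t := Q.s_pos.trans_le Q.s_le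

/-- The closed rectangle. -/
def carrier (Q : FlagRect n m) : Set (FlagSpace n m) := axisCube Q.a Q.s ×ˢ axisCube Q.c Q.t

/-- The half-open rectangle. -/
def core (Q : FlagRect n m) : Set (FlagSpace n m) := halfOpenCube Q.a Q.s ×ˢ halfOpenCube Q.c Q.t

theorem carrier_mem (Q : FlagRect n m) : Q.carrier ∈ flagRectangles n m :=
  ⟨Q.a, Q.c, Q.s, Q.t, Q.s_pos, Q.s_le, rfl⟩

theorem exists_carrier_eq {R : Set (FlagSpace n m)} (hR : R ∈ flagRectangles n m) :
    ∃ Q : FlagRect n m, Q.carrier = R := by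
  obtain ⟨a, c, s, t, hs, hst, rfl⟩ := hR
  exact ⟨⟨a, c, s, t, hs, hst⟩, rfl⟩

theorem core_ae_eq (Q : FlagRect n m) : Q.core =ᵐ[volume] Q.carrier :=
  Measure.set_prod_ae_eq (halfOpenCube_ae_eq_axisCube _ _) (halfOpenCube_ae_eq_axisCube _ _)

theorem measurableSet_core (Q : FlagRect n m) : MeasurableSet Q.core :=
  (measurableSet_halfOpenCube _ _).prod (measurableSet_halfOpenCube _ _)

theorem isCompact_carrier (Q : FlagRect n m) : IsCompact Q.carrier :=
  isCompact_Icc.prod isCompact_Icc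

theorem volume_carrier (Q : FlagRect n m) :
    volume Q.carrier = ENNReal.ofReal (Q.s ^ n * Q.t ^ m) := by
  rw [carrier, Measure.volume_eq_prod, Measure.prod_prod, volume_axisCube, volume_axisCube,
    ENNReal.ofReal_mul (pow_nonneg Q.s_pos.le _), ENNReal.ofReal_pow Q.s_pos.le,
    ENNReal.ofReal_pow Q.t_pos.le]

theorem volume_core (Q : FlagRect n m) : volume Q.core = ENNReal.ofReal (Q.s ^ n * Q.t ^ m) := by
  rw [measure_congr Q.core_ae_eq, volume_carrier]

theorem size_pos (Q : FlagRect n m) : 0 < Q.s ^ n * Q.t ^ m :=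
  mul_pos (pow_pos Q.s_pos _) (pow_pos Q.t_pos _)

theorem volume_carrier_ne_zero (Q : FlagRect n m) : volume Q.carrier ≠ 0 := by
  rw [volume_carrier]; exact (ENNReal.ofReal_pos.2 Q.size_pos).ne'

theorem volume_carrier_ne_top (Q : FlagRect n m) : volume Q.carrier ≠ ⊤ := by
  rw [volume_carrier]; exact ENNReal.ofReal_ne_top

/-- The dyadic children of a flag rectangle, obtained by halving all sides. -/
noncomputable def child (Q : FlagRect n m) (e : (Fin n → Bool) × (Fin m → Bool)) :
    FlagRect n m where
  a := halfCorner Q.a Q.s e.1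
  c := halfCorner Q.c Q.t e.2
  s := Q.s / 2
  t := Q.t / 2
  s_pos := half_pos Q.s_pos
  s_le := by linarith [Q.s_le]

/-- The index of the child containing `z`. -/
noncomputable def index (Q : FlagRect n m) (z : FlagSpace n m) :
    (Fin n → Bool) × (Fin m → Bool) :=
  (halfIndex Q.a Q.s z.1, halfIndex Q.c Q.t z.2)

theorem measurable_index (Q : FlagRect n m) : Measurable Q.index :=
  ((measurable_halfIndex _ _).comp measurable_fst).prodMk
    ((measurable_halfIndex _ _).comp measurable_snd)

theorem mem_core_child {Q : FlagRect n m} {e : (Fin n → Bool) × (Fin m → Bool)}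
    {z : FlagSpace n m} : z ∈ (Q.child e).core ↔ z ∈ Q.core ∧ Q.index z = e := by
  simp only [core, child, index, Set.mem_prod, mem_halfOpenCube_halfCorner Q.s_pos,
    mem_halfOpenCube_halfCorner Q.t_pos, Prod.ext_iff]
  tauto

theorem iUnion_core_child (Q : FlagRect n m) : ⋃ e, (Q.child e).core = Q.core := by
  ext z; simp [mem_core_child]

theorem disjoint_core_child (Q : FlagRect n m) :
    Pairwise (Function.onFun Disjoint fun e => (Q.child e).core) := by
  intro e e' h
  refine Set.disjoint_left.2 fun z hz hz' => h ?_
  rw [← (mem_core_child.1 hz).2, (mem_core_child.1 hz').2]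

theorem size_child (Q : FlagRect n m) (e : (Fin n → Bool) × (Fin m → Bool)) :
    (Q.child e).s ^ n * (Q.child e).t ^ m =
      (Fintype.card ((Fin n → Bool) × (Fin m → Bool)) : ℝ)⁻¹ * (Q.s ^ n * Q.t ^ m) := by
  simp [child, div_pow]
  field_simp

/-- The average of `b` over a flag rectangle. -/
noncomputable def avg (b : FlagSpace n m → ℝ) (Q : FlagRect n m) : ℝ := ⨍ z in Q.carrier, b z

theorem avg_eq_core (b : FlagSpace n m → ℝ) (Q : FlagRect n m) :
    avg b Q = (Q.s ^ n * Q.t ^ m)⁻¹ * ∫ z in Q.core, b z := by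
  rw [avg, ← setAverage_congr Q.core_ae_eq, setAverage_eq, measureReal_def, volume_core,
    ENNReal.toReal_ofReal Q.size_pos.le, smul_eq_mul]

theorem integrableOn_carrier {b : FlagSpace n m → ℝ} (hb : LocallyIntegrable b)
    (Q : FlagRect n m) : IntegrableOn b Q.carrier :=
  hb.integrableOn_isCompact Q.isCompact_carrier

theorem integrableOn_core {b : FlagSpace n m → ℝ} (hb : LocallyIntegrable b)
    (Q : FlagRect n m) : IntegrableOn b Q.core :=
  (integrableOn_carrier hb Q).congr_set_ae Q.core_ae_eq

/-- The children have equal volume, so no weights appear in the mean. -/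
theorem avg_harmonic {b : FlagSpace n m → ℝ} (hb : LocallyIntegrable b) (Q : FlagRect n m) :
    avg b Q = (Fintype.card ((Fin n → Bool) × (Fin m → Bool)) : ℝ)⁻¹ *
      ∑ e, avg b (Q.child e) := by
  have hQ := Q.size_pos
  simp only [avg_eq_core, size_child, ← Finset.mul_sum]
  rw [← Q.iUnion_core_child, integral_iUnion_fintype (fun e => (Q.child e).measurableSet_core)
    Q.disjoint_core_child (fun e => integrableOn_core hb _)]
  field_simp

/-- The `k`-th generation dyadic descendant of `Q` containing `z`. -/
noncomputable def descendant : ℕ → FlagRect n m → FlagSpace n m → FlagRect n m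
  | 0, Q, _ => Q
  | k + 1, Q, z => descendant k (Q.child (Q.index z)) z

theorem mem_core_descendant (k : ℕ) (Q : FlagRect n m) {z : FlagSpace n m} (hz : z ∈ Q.core) :
    z ∈ (descendant k Q z).core := by
  induction k generalizing Q with
  | zero => exact hz
  | succ k ih => exact ih _ (mem_core_child.2 ⟨hz, rfl⟩)

theorem descendant_s (k : ℕ) (Q : FlagRect n m) (z : FlagSpace n m) :
    (descendant k Q z).s = Q.s / 2 ^ k := by
  induction k generalizing Q with
  | zero => simp [descendant]
  | succ k ih => rw [descendant, ih, child, div_div, pow_succ']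

theorem descendant_t (k : ℕ) (Q : FlagRect n m) (z : FlagSpace n m) :
    (descendant k Q z).t = Q.t / 2 ^ k := by
  induction k generalizing Q with
  | zero => simp [descendant]
  | succ k ih => rw [descendant, ih, child, div_div, pow_succ']

/-- Any `g` is allowed: each generation has finitely many descendants, selected by a measurable
index. -/
theorem measurable_descendant {β : Type*} [MeasurableSpace β] (g : FlagRect n m → β) (k : ℕ)
    (Q : FlagRect n m) : Measurable fun z => g (descendant k Q z) := by
  induction k generalizing Q with
  | zero => simpa only [descendant] using measurable_const
  | succ k ih =>
    have h : Measurable fun q : ((Fin n → Bool) × (Fin m → Bool)) × FlagSpace n m =>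
        g (descendant k (Q.child q.1) q.2) :=
      measurable_from_prod_countable_right fun e => ih (Q.child e)
    exact h.comp (Q.measurable_index.prodMk measurable_id)

/-- Translates tree means into integrals, so that the tree inequality becomes a statement about step
functions on `Q.core`. -/
theorem setLIntegral_descendant {g : FlagRect n m → ℝ} (hg : ∀ Q, 0 ≤ g Q) (k : ℕ)
    (Q : FlagRect n m) : ∫⁻ z in Q.core, ENNReal.ofReal (g (descendant k Q z)) =
      ENNReal.ofReal (Q.s ^ n * Q.t ^ m * descendantMean child k g Q) := by
  induction k generalizing Q with
  | zero =>
    simp only [descendant, descendantMean, lintegral_const, Measure.restrict_apply_univ,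
      volume_core]
    rw [mul_comm, ENNReal.ofReal_mul Q.size_pos.le]
  | succ k ih =>
    have h1 : ∀ e, ∫⁻ z in (Q.child e).core, ENNReal.ofReal (g (descendant (k + 1) Q z)) =
        ENNReal.ofReal ((Q.child e).s ^ n * (Q.child e).t ^ m *
          descendantMean child k g (Q.child e)) := by
      intro e
      rw [← ih]
      refine setLIntegral_congr_fun (Q.child e).measurableSet_core fun z hz => ?_
      simp only [descendant, (mem_core_child.1 hz).2]
    rw [← Q.iUnion_core_child, lintegral_iUnion (fun e => (Q.child e).measurableSet_core)
      Q.disjoint_core_child, tsum_fintype, Finset.sum_congr rfl fun e _ => h1 e,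
      ← ENNReal.ofReal_sum_of_nonneg fun e _ => mul_nonneg (Q.child e).size_pos.le
        (descendantMean_nonneg hg _ _)]
    congr 1
    simp only [size_child, descendantMean, ← Finset.mul_sum]
    ring

end FlagRect

/-! ### Lebesgue differentiation and John–Nirenberg on flag rectangles -/

theorem interior_axisCube_nonempty {d : ℕ} (a : Fin d → ℝ) {s : ℝ} (hs : 0 < s) :
    (interior (axisCube a s)).Nonempty := by
  refine ⟨fun i => a i + s / 2, interior_maximal (s := axisCube a s)
    (t := Set.univ.pi fun i => Set.Ioo (a i) (a i + s)) ?_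
    (isOpen_set_pi Set.finite_univ fun _ _ => isOpen_Ioo) ?_⟩
  · intro x hx
    exact ⟨fun i => (hx i trivial).1.le, fun i => (hx i trivial).2.le⟩
  · intro i _
    constructor <;> linarith

theorem axisCube_subset_closedBall {d : ℕ} {a : Fin d → ℝ} {s : ℝ} (hs : 0 ≤ s) {x : Fin d → ℝ}
    (hx : x ∈ axisCube a s) : axisCube a s ⊆ closedBall x s := by
  intro y hy
  rw [mem_closedBall, dist_pi_le_iff hs]
  intro i
  have h1 := hx.1 i
  have h2 := hx.2 i
  have h3 := hy.1 i
  have h4 := hy.2 i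
  simp only at h2 h4
  rw [Real.dist_eq, abs_le]
  constructor <;> linarith

theorem volume_closedBall_flagSpace {n m : ℕ} (x : FlagSpace n m) {r : ℝ} (hr : 0 ≤ r) :
    volume (closedBall x r) = ENNReal.ofReal ((2 * r) ^ n * (2 * r) ^ m) := by
  rw [← closedBall_prod_same, Measure.volume_eq_prod, Measure.prod_prod,
    Real.volume_pi_closedBall _ hr, Real.volume_pi_closedBall _ hr,
    ENNReal.ofReal_mul (by positivity)]
  simp

namespace FlagRect

variable {n m : ℕ}

theorem core_subset_carrier (Q : FlagRect n m) : Q.core ⊆ Q.carrier := by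
  rintro z ⟨h1, h2⟩
  exact ⟨⟨fun i => (h1 i trivial).1, fun i => (h1 i trivial).2.le⟩,
    ⟨fun i => (h2 i trivial).1, fun i => (h2 i trivial).2.le⟩⟩

theorem carrier_subset_closedBall (Q : FlagRect n m) {z : FlagSpace n m} (hz : z ∈ Q.carrier) :
    Q.carrier ⊆ closedBall z Q.t := by
  rw [← closedBall_prod_same]
  exact Set.prod_mono ((axisCube_subset_closedBall Q.s_pos.le hz.1).trans
    (closedBall_subset_closedBall Q.s_le)) (axisCube_subset_closedBall Q.t_pos.le hz.2)

theorem interior_carrier_nonempty (Q : FlagRect n m) : (interior Q.carrier).Nonempty := by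
  rw [carrier, interior_prod_eq]
  exact (interior_axisCube_nonempty _ Q.s_pos).prod (interior_axisCube_nonempty _ Q.t_pos)

/-- Lebesgue differentiation along the dyadic descendants of a flag rectangle. -/
theorem ae_tendsto_avg_descendant {b : FlagSpace n m → ℝ} (hb : LocallyIntegrable b)
    (Q : FlagRect n m) : ∀ᵐ z, z ∈ Q.core →
      Tendsto (fun k => avg b (descendant k Q z)) atTop (𝓝 (b z)) := by
  have hs := Q.s_pos
  have ht := Q.t_pos
  -- This is (6t)^(n+m) / (s^n t^m), the volume ratio of a ball of radius 3t to the rectangle, and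
  -- halving preserves it. Its dependence on `Q` is harmless: only almost everywhere convergence is
  -- extracted.
  set C : NNReal := Real.toNNReal (6 ^ n * 6 ^ m * (Q.t / Q.s) ^ n) with hC
  have hCe : (C : ENNReal) = ENNReal.ofReal (6 ^ n * 6 ^ m * (Q.t / Q.s) ^ n) := rfl
  have hball : ∀ x : FlagSpace n m, ∃ᶠ r in 𝓝[>] (0 : ℝ),
      volume (closedBall x (3 * r)) ≤ C * volume (closedBall x r) := by
    intro x
    refine Eventually.frequently ?_
    filter_upwards [self_mem_nhdsWithin] with r hr
    have hr : (0 : ℝ) < r := hr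
    rw [volume_closedBall_flagSpace x (by positivity), volume_closedBall_flagSpace x hr.le, hCe,
      ← ENNReal.ofReal_mul (by positivity)]
    refine ENNReal.ofReal_le_ofReal ?_
    have h1 : 1 ≤ (Q.t / Q.s) ^ n := one_le_pow₀ ((one_le_div hs).2 Q.s_le)
    have h2 : (2 * (3 * r)) ^ n * (2 * (3 * r)) ^ m = 6 ^ n * 6 ^ m * (r ^ n * r ^ m) := by
      rw [show 2 * (3 * r) = 6 * r by ring, mul_pow, mul_pow]; ring
    have h3 : r ^ n * r ^ m ≤ (2 * r) ^ n * (2 * r) ^ m := by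
      gcongr <;> linarith
    rw [h2]
    calc 6 ^ n * 6 ^ m * (r ^ n * r ^ m) ≤ 6 ^ n * 6 ^ m * ((2 * r) ^ n * (2 * r) ^ m) := by
          gcongr
      _ = 6 ^ n * 6 ^ m * 1 * ((2 * r) ^ n * (2 * r) ^ m) := by ring
      _ ≤ _ := by gcongr
  filter_upwards [(Vitali.vitaliFamily (volume : Measure (FlagSpace n m)) C
    hball).ae_tendsto_average hb] with z hz hzQ
  have hmem : ∀ k, z ∈ (descendant k Q z).carrier := fun k =>
    core_subset_carrier _ (mem_core_descendant k Q hzQ)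
  refine hz.comp ((VitaliFamily.tendsto_filterAt_iff _).2 ⟨Eventually.of_forall fun k => ?_, ?_⟩)
  · refine ⟨(isCompact_carrier _).isClosed, interior_carrier_nonempty _, (descendant k Q z).t,
      carrier_subset_closedBall _ (hmem k), ?_⟩
    rw [volume_closedBall_flagSpace z (mul_nonneg (by norm_num) (t_pos _).le), volume_carrier, hCe,
      ← ENNReal.ofReal_mul (by positivity), descendant_s, descendant_t]
    refine ENNReal.ofReal_le_ofReal (le_of_eq ?_)
    rw [show 2 * (3 * (Q.t / 2 ^ k)) = 6 * (Q.t / 2 ^ k) by ring]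
    simp only [mul_pow, div_pow]
    field_simp
  · intro ε hε
    have hlim : Tendsto (fun k : ℕ => Q.t * (1 / 2) ^ k) atTop (𝓝 (Q.t * 0)) :=
      (tendsto_pow_atTop_nhds_zero_of_lt_one (by norm_num) (by norm_num)).const_mul _
    rw [mul_zero] at hlim
    filter_upwards [hlim.eventually (gt_mem_nhds hε)] with k hk
    refine (carrier_subset_closedBall _ (hmem k)).trans (closedBall_subset_closedBall ?_)
    rw [descendant_t, div_eq_mul_one_div, ← one_div_pow]
    exact hk.le

theorem locallyIntegrable_abs_sub {b : FlagSpace n m → ℝ} (hb : LocallyIntegrable b) (α : ℝ) :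
    LocallyIntegrable fun z => |b z - α| :=
  fun z => (hb.sub (locallyIntegrable_const α) z).norm

theorem ofReal_avg {F : FlagSpace n m → ℝ} (hF : LocallyIntegrable F) (h0 : ∀ z, 0 ≤ F z)
    (Q : FlagRect n m) :
    ENNReal.ofReal (avg F Q) = ⨍⁻ z in Q.carrier, ENNReal.ofReal (F z) ∂volume := by
  rw [avg, ofReal_setAverage (integrableOn_carrier hF Q) (Eventually.of_forall h0), setLAverage_eq]

theorem abs_avg_sub_le {b : FlagSpace n m → ℝ} (hb : LocallyIntegrable b) (α : ℝ)
    (Q : FlagRect n m) : |avg b Q - α| ≤ avg (fun z => |b z - α|) Q := by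
  have hQ := Q.size_pos
  have h1 : avg b Q - α = (Q.s ^ n * Q.t ^ m)⁻¹ * ∫ z in Q.core, (b z - α) := by
    rw [integral_sub (integrableOn_core hb Q)
      (integrableOn_core (locallyIntegrable_const α) Q), avg_eq_core, mul_sub]
    simp [measureReal_def, volume_core, ENNReal.toReal_ofReal hQ.le]
    have hs := Q.s_pos
    have ht := Q.t_pos
    field_simp
  rw [h1, avg_eq_core, abs_mul, abs_of_pos (inv_pos.2 hQ)]
  exact mul_le_mul_of_nonneg_left abs_integral_le_integral_abs (inv_pos.2 hQ).le

/-- The John–Nirenberg inequality for little flag BMO. -/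
theorem setLAverage_exp_le {b : FlagSpace n m → ℝ} (hb : LocallyIntegrable b) {M l : ℝ}
    (hM : 0 < M) (hl : 0 ≤ l)
    (hosc : ∀ Q : FlagRect n m,
      ⨍⁻ z in Q.carrier, ENNReal.ofReal |b z - avg b Q| ∂volume ≤ ENNReal.ofReal M)
    (hlM : Real.exp (l * (2 * M + Fintype.card ((Fin n → Bool) × (Fin m → Bool)) * M)) ≤ 3 / 2)
    (Q : FlagRect n m) :
    ⨍⁻ z in Q.carrier, ENNReal.ofReal (Real.exp (l * |b z - avg b Q|)) ∂volume ≤ 6 := by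
  have hosc' : ∀ k (Q : FlagRect n m),
      descendantMean child k (fun Q' => |avg b Q' - avg b Q|) Q ≤ M := by
    intro k Q
    have hF := locallyIntegrable_abs_sub hb (avg b Q)
    -- The averages of |b - α| are themselves harmonic, so their mean over any generation collapses
    -- to the oscillation on `Q`.
    refine (descendantMean_mono (fun Q' => abs_avg_sub_le hb (avg b Q) Q') k Q).trans ?_
    rw [descendantMean_of_harmonic (avg_harmonic hF)]
    have h := hosc Q
    rwa [← ofReal_avg hF (fun z => abs_nonneg _), ENNReal.ofReal_le_ofReal_iff hM.le] at h
  have hk : ∀ k, ∫⁻ z in Q.core,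
      ENNReal.ofReal (Real.exp (l * |avg b (descendant k Q z) - avg b Q|)) ≤
        6 * volume Q.core := by
    intro k
    rw [setLIntegral_descendant (g := fun Q' => Real.exp (l * |avg b Q' - avg b Q|))
      (fun _ => (Real.exp_pos _).le), volume_core, ← ENNReal.ofReal_ofNat,
      ← ENNReal.ofReal_mul (by norm_num), mul_comm]
    exact ENNReal.ofReal_le_ofReal (mul_le_mul_of_nonneg_right
      (descendantMean_exp_le (avg_harmonic hb) hM hl hosc' hlM k Q) Q.size_pos.le)
  rw [setLAverage_eq, ENNReal.div_le_iff Q.volume_carrier_ne_zero Q.volume_carrier_ne_top,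
    ← setLIntegral_congr Q.core_ae_eq, ← measure_congr Q.core_ae_eq]
  -- Fatou, along the averages over shrinking descendants, which converge to b almost everywhere.
  calc ∫⁻ z in Q.core, ENNReal.ofReal (Real.exp (l * |b z - avg b Q|))
      ≤ ∫⁻ z in Q.core, liminf (fun k => ENNReal.ofReal
          (Real.exp (l * |avg b (descendant k Q z) - avg b Q|))) atTop := by
        refine lintegral_mono_ae ?_
        rw [ae_restrict_iff' Q.measurableSet_core]
        filter_upwards [ae_tendsto_avg_descendant hb Q] with z hz hzQ
        have hcont : Continuous fun x : ℝ =>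
            ENNReal.ofReal (Real.exp (l * |x - avg b Q|)) :=
          ENNReal.continuous_ofReal.comp (by fun_prop)
        exact ((hcont.tendsto _).comp (hz hzQ)).liminf_eq.ge
    _ ≤ liminf (fun k => ∫⁻ z in Q.core, ENNReal.ofReal
          (Real.exp (l * |avg b (descendant k Q z) - avg b Q|))) atTop :=
        lintegral_liminf_le fun k => measurable_descendant
          (fun Q' => ENNReal.ofReal (Real.exp (l * |avg b Q' - avg b Q|))) k Q
    _ ≤ 6 * volume Q.core := liminf_le_of_le (by isBoundedDefault) fun c hc => by
        obtain ⟨k, hck⟩ := hc.exists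
        exact hck.trans (hk k)

end FlagRect

/-! ### Exponential moments and oscillation on a probability space -/

theorem abs_le_exp_add_mul_exp {q : ℝ} (hq : 0 < q) (x : ℝ) :
    |x| ≤ Real.exp x + q * Real.exp (-q⁻¹ * x) := by
  rcases le_total 0 x with hx | hx
  · rw [abs_of_nonneg hx]
    have h1 := Real.add_one_le_exp x
    have h2 : 0 ≤ q * Real.exp (-q⁻¹ * x) := by positivity
    linarith
  · rw [abs_of_nonpos hx]
    have h1 := mul_le_mul_of_nonneg_left (Real.add_one_le_exp (-q⁻¹ * x)) hq.le
    have h2 : q * (-q⁻¹ * x + 1) = -x + q := by field_simp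
    have h3 := Real.exp_pos x
    linarith

section Probability

variable {Ω : Type*} [MeasurableSpace Ω] {ν : Measure Ω}

theorem integrable_of_integrable_exp {b : Ω → ℝ} {q : ℝ} (hq : 0 < q)
    (hb : AEStronglyMeasurable b ν) (h1 : Integrable (fun z => Real.exp (b z)) ν)
    (h2 : Integrable (fun z => Real.exp (-q⁻¹ * b z)) ν) : Integrable b ν :=
  (h1.add (h2.const_mul q)).mono' hb (Eventually.of_forall fun z =>
    abs_le_exp_add_mul_exp hq (b z))

theorem exp_integral_le_integral_exp [IsProbabilityMeasure ν] {b : Ω → ℝ} (hb : Integrable b ν)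
    (h : Integrable (fun z => Real.exp (b z)) ν) :
    Real.exp (∫ z, b z ∂ν) ≤ ∫ z, Real.exp (b z) ∂ν :=
  convexOn_exp.map_integral_le Real.continuous_exp.continuousOn isClosed_univ
    (Eventually.of_forall fun _ => trivial) hb h

/-- After recentring at β the product is unchanged, because e^(-β) (e^(β/q))^q = 1. Jensen gives `1
≤ X` and `1 ≤ Y`, so `X * Y ^ q ≤ C` bounds each factor separately. -/
theorem integral_abs_sub_integral_le [IsProbabilityMeasure ν] {b : Ω → ℝ} {q C : ℝ} (hq : 0 < q)
    (hb : AEStronglyMeasurable b ν) (h1 : Integrable (fun z => Real.exp (b z)) ν)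
    (h2 : Integrable (fun z => Real.exp (-q⁻¹ * b z)) ν)
    (hC : (∫ z, Real.exp (b z) ∂ν) * (∫ z, Real.exp (-q⁻¹ * b z) ∂ν) ^ q ≤ C) :
    ∫ z, |b z - ∫ y, b y ∂ν| ∂ν ≤ C + q * C ^ q⁻¹ := by
  have hbi := integrable_of_integrable_exp hq hb h1 h2
  set β := ∫ y, b y ∂ν with hβ
  set X := Real.exp (-β) * ∫ z, Real.exp (b z) ∂ν with hX
  set Y := Real.exp (q⁻¹ * β) * ∫ z, Real.exp (-q⁻¹ * b z) ∂ν with hY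
  have hX1 : 1 ≤ X := by
    have h := mul_le_mul_of_nonneg_left (exp_integral_le_integral_exp hbi h1)
      (Real.exp_pos (-β)).le
    rwa [← hβ, ← Real.exp_add, neg_add_cancel, Real.exp_zero] at h
  have hY1 : 1 ≤ Y := by
    have h := mul_le_mul_of_nonneg_left
      (exp_integral_le_integral_exp (hbi.const_mul (-q⁻¹)) h2) (Real.exp_pos (q⁻¹ * β)).le
    rwa [integral_const_mul, ← hβ, ← Real.exp_add, ← add_mul, add_neg_cancel, zero_mul,
      Real.exp_zero] at h
  have hXY : X * Y ^ q ≤ C := by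
    refine le_of_eq_of_le ?_ hC
    rw [hX, hY, Real.mul_rpow (Real.exp_pos _).le (integral_nonneg fun z => (Real.exp_pos _).le),
      ← Real.exp_mul, mul_mul_mul_comm, ← Real.exp_add]
    have : -β + q⁻¹ * β * q = 0 := by field_simp; ring
    rw [this, Real.exp_zero, one_mul]
  have hYq : 1 ≤ Y ^ q := Real.one_le_rpow hY1 hq.le
  have hXC : X ≤ C := by nlinarith
  have hYC : Y ≤ C ^ q⁻¹ := by
    have h : Y ^ q ≤ C := by nlinarith
    have h' := Real.rpow_le_rpow (by positivity) h (inv_nonneg.2 hq.le)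
    rwa [← Real.rpow_mul (by linarith), mul_inv_cancel₀ hq.ne', Real.rpow_one] at h'
  calc ∫ z, |b z - β| ∂ν
      ≤ ∫ z, (Real.exp (-β) * Real.exp (b z) +
          q * (Real.exp (q⁻¹ * β) * Real.exp (-q⁻¹ * b z))) ∂ν := by
        refine integral_mono (hbi.sub (integrable_const _)).abs
          ((h1.const_mul _).add ((h2.const_mul _).const_mul _)) fun z => ?_
        refine (abs_le_exp_add_mul_exp hq _).trans (le_of_eq ?_)
        rw [← Real.exp_add, ← Real.exp_add]
        ring_nf
    _ = X + q * Y := by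
        rw [integral_add (h1.const_mul _) ((h2.const_mul _).const_mul _), integral_const_mul,
          integral_const_mul, integral_const_mul]
    _ ≤ C + q * C ^ q⁻¹ := add_le_add hXC (mul_le_mul_of_nonneg_left hYC hq.le)

theorem log_integrable_and_lintegral_le [IsProbabilityMeasure ν] {w : Ω → ℝ} {q : ℝ} (hq : 0 < q)
    (hw : ∀ᵐ z ∂ν, 0 < w z) (hi : Integrable w ν) {K : ENNReal} (hK : K ≠ ⊤)
    (h : (∫⁻ z, ENNReal.ofReal (w z) ∂ν) * (∫⁻ z, ENNReal.ofReal (w z ^ (-q⁻¹)) ∂ν) ^ q ≤ K) :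
    Integrable (fun z => Real.log (w z)) ν ∧
      ∫⁻ z, ENNReal.ofReal |Real.log (w z) - ∫ y, Real.log (w y) ∂ν| ∂ν ≤
        ENNReal.ofReal (K.toReal + q * K.toReal ^ q⁻¹) := by
  have hwm : AEMeasurable w ν := hi.1.aemeasurable
  have hb : AEStronglyMeasurable (fun z => Real.log (w z)) ν :=
    (Real.measurable_log.comp_aemeasurable hwm).aestronglyMeasurable
  have e1 : (fun z => w z) =ᵐ[ν] fun z => Real.exp (Real.log (w z)) := by
    filter_upwards [hw] with z hz using (Real.exp_log hz).symm
  have e2 : (fun z => w z ^ (-q⁻¹)) =ᵐ[ν] fun z => Real.exp (-q⁻¹ * Real.log (w z)) := by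
    filter_upwards [hw] with z hz
    rw [Real.rpow_def_of_pos hz, mul_comm]
  -- Needed because 0 * ⊤ = 0: a finite product forces the dual integral to be finite only if the
  -- first factor is nonzero.
  have hA0 : ∫⁻ z, ENNReal.ofReal (w z) ∂ν ≠ 0 := by
    intro h0
    rw [lintegral_eq_zero_iff' hwm.ennreal_ofReal] at h0
    obtain ⟨z, hz, hz'⟩ := (h0.and hw).exists
    exact (ENNReal.ofReal_pos.2 hz').ne' hz
  have hB : ∫⁻ z, ENNReal.ofReal (w z ^ (-q⁻¹)) ∂ν ≠ ⊤ := by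
    intro hB
    rw [hB, ENNReal.top_rpow_of_pos hq, ENNReal.mul_top hA0] at h
    exact hK (top_le_iff.1 h)
  have hpow0 : 0 ≤ᵐ[ν] fun z => w z ^ (-q⁻¹) := by
    filter_upwards [hw] with z hz using (Real.rpow_pos_of_pos hz _).le
  have hi2 : Integrable (fun z => w z ^ (-q⁻¹)) ν :=
    (lintegral_ofReal_ne_top_iff_integrable (hwm.pow_const _).aestronglyMeasurable hpow0).1 hB
  have h1 := hi.congr e1
  have h2 := hi2.congr e2
  have hbi := integrable_of_integrable_exp hq hb h1 h2
  refine ⟨hbi, ?_⟩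
  rw [← ofReal_integral_eq_lintegral_ofReal
    (f := fun z => |Real.log (w z) - ∫ y, Real.log (w y) ∂ν|)
    (hbi.sub (integrable_const _)).abs (Eventually.of_forall fun z => abs_nonneg _)]
  refine ENNReal.ofReal_le_ofReal (integral_abs_sub_integral_le hq hb h1 h2 ?_)
  rw [← integral_congr_ae e1, ← integral_congr_ae e2,
    integral_eq_lintegral_of_nonneg_ae (hw.mono fun z hz => hz.le) hi.1,
    integral_eq_lintegral_of_nonneg_ae hpow0 hi2.1, ENNReal.toReal_rpow, ← ENNReal.toReal_mul]
  exact ENNReal.toReal_mono hK h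

/-- The sign of `r` is free, so one exponential bound serves both w^η and its dual power. -/
theorem lintegral_rpow_le {w : Ω → ℝ} (hw : ∀ᵐ z ∂ν, 0 < w z) {l r β : ℝ} (hr : |r| ≤ l)
    (h : ∫⁻ z, ENNReal.ofReal (Real.exp (l * |Real.log (w z) - β|)) ∂ν ≤ 6) :
    ∫⁻ z, ENNReal.ofReal (w z ^ r) ∂ν ≤ ENNReal.ofReal (Real.exp (r * β)) * 6 := by
  refine le_trans ?_ (mul_le_mul_right h _)
  rw [← lintegral_const_mul' _ _ ENNReal.ofReal_ne_top]
  refine lintegral_mono_ae ?_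
  filter_upwards [hw] with z hz
  rw [← ENNReal.ofReal_mul (Real.exp_pos _).le, ← Real.exp_add, Real.rpow_def_of_pos hz]
  refine ENNReal.ofReal_le_ofReal (Real.exp_le_exp.2 ?_)
  have h1 : r * (Real.log (w z) - β) ≤ l * |Real.log (w z) - β| :=
    (le_abs_self _).trans (by rw [abs_mul]; exact mul_le_mul_of_nonneg_right hr (abs_nonneg _))
  linarith

end Probability

/-! ### Normalized measures on flag rectangles and the two implications -/

namespace FlagRect

variable {n m : ℕ}

theorem exists_carrier_mem_nhds (z : FlagSpace n m) : ∃ Q : FlagRect n m, Q.carrier ∈ 𝓝 z := by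
  refine ⟨⟨fun i => z.1 i - 1, fun i => z.2 i - 1, 2, 2, by norm_num, le_rfl⟩, ?_⟩
  have key : ∀ {d : ℕ} (x : Fin d → ℝ), axisCube (fun i => x i - 1) 2 ∈ 𝓝 x := by
    intro d x
    refine mem_of_superset (closedBall_mem_nhds x one_pos) fun y hy => ?_
    have h : ∀ i, |y i - x i| ≤ 1 := fun i => (dist_le_pi_dist y x i).trans hy
    refine ⟨fun i => ?_, fun i => ?_⟩ <;> have := abs_le.1 (h i) <;> simp only <;> linarith
  exact prod_mem_nhds (key z.1) (key z.2)

theorem locallyIntegrable_of_forall_integrableOn {f : FlagSpace n m → ℝ}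
    (hf : ∀ Q : FlagRect n m, IntegrableOn f Q.carrier) : LocallyIntegrable f := fun z =>
  let ⟨Q, hQ⟩ := exists_carrier_mem_nhds z
  ⟨Q.carrier, hQ, hf Q⟩

/-- The normalized Lebesgue measure on a flag rectangle. -/
noncomputable def unif (Q : FlagRect n m) : Measure (FlagSpace n m) :=
  (volume Q.carrier)⁻¹ • volume.restrict Q.carrier

instance (Q : FlagRect n m) : IsProbabilityMeasure Q.unif := by
  refine ⟨?_⟩
  rw [unif, Measure.smul_apply, Measure.restrict_apply_univ, smul_eq_mul,
    ENNReal.inv_mul_cancel Q.volume_carrier_ne_zero Q.volume_carrier_ne_top]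

theorem integrable_unif_iff (Q : FlagRect n m) {f : FlagSpace n m → ℝ} :
    Integrable f Q.unif ↔ IntegrableOn f Q.carrier :=
  integrable_smul_measure (ENNReal.inv_ne_zero.2 Q.volume_carrier_ne_top)
    (ENNReal.inv_ne_top.2 Q.volume_carrier_ne_zero)

theorem unif_absolutelyContinuous (Q : FlagRect n m) : Q.unif ≪ volume :=
  Measure.AbsolutelyContinuous.smul_left Measure.restrict_le_self.absolutelyContinuous _

theorem laverage_eq_unif (Q : FlagRect n m) (f : FlagSpace n m → ENNReal) :
    ⨍⁻ z in Q.carrier, f z ∂volume = ∫⁻ z, f z ∂Q.unif :=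
  setLAverage_eq' _ _ _

theorem avg_eq_unif (Q : FlagRect n m) (f : FlagSpace n m → ℝ) :
    avg f Q = ∫ z, f z ∂Q.unif :=
  setAverage_eq' _ _ _

end FlagRect

open FlagRect

theorem flagBmoNorm_le {n m : ℕ} {b : FlagSpace n m → ℝ} {K : ENNReal}
    (h : ∀ Q : FlagRect n m,
      ∫⁻ z, ENNReal.ofReal |b z - ∫ y, b y ∂Q.unif| ∂Q.unif ≤ K) : flagBmoNorm b ≤ K := by
  refine iSup₂_le fun R hR => ?_
  obtain ⟨Q, rfl⟩ := exists_carrier_eq hR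
  rw [laverage_eq_unif]
  have := h Q
  rwa [← avg_eq_unif] at this

theorem le_flagBmoNorm {n m : ℕ} (b : FlagSpace n m → ℝ) (Q : FlagRect n m) :
    ⨍⁻ z in Q.carrier, ENNReal.ofReal |b z - avg b Q| ∂volume ≤ flagBmoNorm b :=
  le_iSup₂_of_le Q.carrier Q.carrier_mem le_rfl

theorem one_sub_div_sub_one {p : ℝ} (hp : 1 < p) : 1 - p / (p - 1) = -(p - 1)⁻¹ := by
  have : p - 1 ≠ 0 := by linarith
  field_simp
  ring

theorem log_mem_flagBmo {n m : ℕ} {p : ℝ} (hp : 1 < p) {w : FlagSpace n m → ℝ}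
    (hw : w ∈ flagAp n m p) : (fun z => Real.log (w z)) ∈ flagBmo n m := by
  obtain ⟨hpos, hloc, hA⟩ := hw
  have hq : 0 < p - 1 := by linarith
  have key : ∀ Q : FlagRect n m, _ := fun Q =>
    log_integrable_and_lintegral_le (ν := Q.unif) hq (Q.unif_absolutelyContinuous.ae_le hpos)
      (Q.integrable_unif_iff.2 (integrableOn_carrier hloc Q)) hA.ne (by
        rw [← one_sub_div_sub_one hp, ← laverage_eq_unif, ← laverage_eq_unif]
        exact le_iSup₂_of_le (f := fun R (_ : R ∈ flagRectangles n m) => _)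
          Q.carrier Q.carrier_mem le_rfl)
  exact ⟨locallyIntegrable_of_forall_integrableOn fun Q => Q.integrable_unif_iff.1 (key Q).1,
    (flagBmoNorm_le fun Q => (key Q).2).trans_lt ENNReal.ofReal_lt_top⟩

theorem exists_lintegral_exp_le {n m : ℕ} {b : FlagSpace n m → ℝ} (hb : b ∈ flagBmo n m) :
    ∃ l : ℝ, 0 < l ∧ ∀ Q : FlagRect n m,
      ∫⁻ z, ENNReal.ofReal (Real.exp (l * |b z - avg b Q|)) ∂Q.unif ≤ 6 := by
  obtain ⟨hloc, hfin⟩ := hb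
  -- Adding 1 keeps `M` positive even when the norm vanishes.
  set M := (flagBmoNorm b).toReal + 1 with hM
  have hM0 : 0 < M := by positivity
  have hD : 0 < 2 * M + Fintype.card ((Fin n → Bool) × (Fin m → Bool)) * M := by positivity
  -- This exponent turns the smallness condition of the tree inequality into an equality.
  refine ⟨Real.log (3 / 2) / (2 * M + Fintype.card ((Fin n → Bool) × (Fin m → Bool)) * M),
    div_pos (Real.log_pos (by norm_num)) hD, fun Q => ?_⟩
  rw [← laverage_eq_unif]
  refine setLAverage_exp_le hloc hM0 (div_pos (Real.log_pos (by norm_num)) hD).le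
    (fun Q => (le_flagBmoNorm b Q).trans ?_) ?_ Q
  · rw [ENNReal.le_ofReal_iff_toReal_le hfin.ne hM0.le]
    linarith
  · rw [div_mul_cancel₀ _ hD.ne', Real.exp_log (by norm_num)]

theorem rpow_mem_flagAp {n m : ℕ} {p : ℝ} (hp : 1 < p) {w : FlagSpace n m → ℝ}
    (hw : ∀ᵐ z, 0 < w z) (hb : LocallyIntegrable (fun z => Real.log (w z))) {l η : ℝ}
    (hη : 0 < η) (hl : η ≤ l) (hl' : η ≤ l * (p - 1))
    (hexp : ∀ Q : FlagRect n m, ∫⁻ z, ENNReal.ofReal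
      (Real.exp (l * |Real.log (w z) - avg (fun z => Real.log (w z)) Q|)) ∂Q.unif ≤ 6) :
    (fun z => w z ^ η) ∈ flagAp n m p := by
  have hq : 0 < p - 1 := by linarith
  have hwQ : ∀ Q : FlagRect n m, ∀ᵐ z ∂Q.unif, 0 < w z := fun Q =>
    Q.unif_absolutelyContinuous.ae_le hw
  have h1 : ∀ Q : FlagRect n m, _ := fun Q =>
    lintegral_rpow_le (hwQ Q) (r := η) (by rwa [abs_of_pos hη]) (hexp Q)
  have h2 : ∀ Q : FlagRect n m, _ := fun Q =>
    lintegral_rpow_le (hwQ Q) (r := η * -(p - 1)⁻¹) (by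
      rw [mul_neg, abs_neg, abs_of_pos (by positivity), ← div_eq_mul_inv, div_le_iff₀ hq]
      exact hl') (hexp Q)
  -- Measurability comes from log w, since w itself is not known to be measurable here.
  have hmeas : AEStronglyMeasurable (fun z => w z ^ η) volume := by
    have h : (fun z => Real.exp (Real.log (w z) * η)) =ᵐ[volume] fun z => w z ^ η := by
      filter_upwards [hw] with z hz using (Real.rpow_def_of_pos hz η).symm
    exact (Real.continuous_exp.comp_aestronglyMeasurable
      (hb.aestronglyMeasurable.mul_const η)).congr h
  have hpow : ∀ᵐ z, 0 < w z ^ η := hw.mono fun z hz => Real.rpow_pos_of_pos hz η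
  refine ⟨hpow, locallyIntegrable_of_forall_integrableOn fun Q => Q.integrable_unif_iff.1 ?_, ?_⟩
  · refine (lintegral_ofReal_ne_top_iff_integrable
      (hmeas.mono_ac Q.unif_absolutelyContinuous)
      ((hwQ Q).mono fun z hz => (Real.rpow_pos_of_pos hz η).le)).1
      ((h1 Q).trans_lt ?_).ne
    exact ENNReal.mul_lt_top ENNReal.ofReal_lt_top (by norm_num)
  · have hfin : (6 : ENNReal) * 6 ^ (p - 1) < ⊤ :=
      ENNReal.mul_lt_top (by norm_num) (ENNReal.rpow_lt_top_of_nonneg hq.le (by norm_num))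
    refine lt_of_le_of_lt (iSup₂_le fun R hR => ?_) hfin
    obtain ⟨Q, rfl⟩ := exists_carrier_eq hR
    rw [laverage_eq_unif, laverage_eq_unif, one_sub_div_sub_one hp]
    have e : ∫⁻ z, ENNReal.ofReal ((w z ^ η) ^ (-(p - 1)⁻¹)) ∂Q.unif =
        ∫⁻ z, ENNReal.ofReal (w z ^ (η * -(p - 1)⁻¹)) ∂Q.unif :=
      lintegral_congr_ae ((hwQ Q).mono fun z hz => by
        simp only [Real.rpow_mul hz.le])
    rw [e]
    refine (mul_le_mul' (h1 Q) (ENNReal.rpow_le_rpow (h2 Q) hq.le)).trans (le_of_eq ?_)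
    rw [ENNReal.mul_rpow_of_nonneg _ _ hq.le, mul_mul_mul_comm,
      ENNReal.ofReal_rpow_of_pos (Real.exp_pos _), ← ENNReal.ofReal_mul (Real.exp_pos _).le,
      ← Real.exp_mul, ← Real.exp_add]
    -- The dual factor is raised to the power p - 1, so the exponentials of the average cancel and
    -- the bound no longer depends on `Q`.
    have : ∀ β : ℝ, η * β + η * -(p - 1)⁻¹ * β * (p - 1) = 0 := by
      intro β; field_simp; ring
    rw [this, Real.exp_zero, ENNReal.ofReal_one, one_mul]

theorem mainTheorem7 (n m : ℕ) (hn : 0 < n) (hm : 0 < m) (p : ℝ) (hp : 1 < p)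
    (w : FlagSpace n m → ℝ) (hw : ∀ᵐ z, 0 < w z) :
    (w ∈ flagAp n m p → (fun z => Real.log (w z)) ∈ flagBmo n m) ∧
    ((fun z => Real.log (w z)) ∈ flagBmo n m →
      ∃ η₀ : ℝ, 0 < η₀ ∧ ∀ η : ℝ, 0 < η → η < η₀ → (fun z => w z ^ η) ∈ flagAp n m p) := by
  refine ⟨log_mem_flagBmo hp, fun hb => ?_⟩
  obtain ⟨l, hl, hexp⟩ := exists_lintegral_exp_le hb
  have hq : 0 < p - 1 := by linarith
  exact ⟨min l (l * (p - 1)), lt_min hl (mul_pos hl hq), fun η hη hlt =>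
    rpow_mem_flagAp hp hw hb.1 hη (hlt.le.trans (min_le_left _ _))
      (hlt.le.trans (min_le_right _ _)) hexp⟩
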